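/- Let $G$ be a second countable, locally compact (Hausdorff) abelian group, written additively, with Haar measure $\mu_G$, and let $\widehat G$ be its character group, equipped with the Plancherel measure $\mu_{\widehat G}$, i.e. the Haar measure on $\widehat G$ for which the Fourier transform $\hat f(\omega)=\int_G f(x)\overline{\omega(x)}\,d\mu_G(x)$ satisfies $\|\hat f\|_{L^2(\widehat G)}=\|f\|_{L^2(G)}$ for all $f\in L^1(G)\cap L^2(G)$; the same symbol $\hat f$ denotes its continuous extension to $f \in L^2(G)$. For $\gamma\in G$ let $T_\gamma f=f(\cdot-\gamma)$. Let $(P,\Sigma_P,\mu_P)$ be a $\sigma$-finite measure space and let $(g_p)_{p\in P}$ be a family in $L^2(G)$ such that $p\mapsto g_p$ is measurable from $(P,\Sigma_P)$ to $L^2(G)$ with its Borel $\sigma$-algebra, and such that (for suitable representatives of the classes $g_p$) the map $(p,x)\mapsto g_p(x)$ is measurable on $P\times G$ with respect to $\Sigma_P\otimes\mathcal B_G$. Let $0<A\le B<\infty$. Then representatives of the classes $\hat g_p\in L^2(\widehat G)$, $p \in P$, can be chosen such that $(p,\omega)\mapsto\hat g_p(\omega)$ is measurable with respect to $\Sigma_P\otimes\mathcal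 B_{\widehat G}$, and for every such choice the following are equivalent: (a) the system $\{T_\gamma g_p\}_{\gamma\in G,\,p\in P}$ is a frame for $L^2(G)$ with frame bounds $A$ and $B$, that is, for all $f\in L^2(G)$, $$A\|f\|^2\le\int_P\int_G|\langle f,T_\gamma g_p\rangle|^2\,d\mu_G(\gamma)\,d\mu_P(p)\le B\|f\|^2;$$ (b) for $\mu_{\widehat G}$-almost every $\omega\in\widehat G$, $$A\le\int_P|\hat g_p(\omega)|^2\,d\mu_P(p)\le B.$$ -/

import Mathlib

open MeasureTheory
open scoped ENNReal

noncomputable section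

set_option linter.unusedSectionVars false

namespace TISystem

/-- The character group of the additive group `G`: all continuous homomorphisms from `G` to the
circle group, with the compact-open topology. (Mathlib's `PontryaginDual` is written for
multiplicative groups. The group law of the dual is pointwise multiplication of characters.) -/
abbrev Dual (G : Type*) [AddCommGroup G] [TopologicalSpace G] : Type _ :=
  PontryaginDual (Multiplicative G)

section Fourier

variable {G : Type*} [AddCommGroup G] [TopologicalSpace G] [MeasurableSpace G]

/-- The value `ω(x)` of a character, as a complex number. -/
def char (ω : Dual G) (x : G) : ℂ := (ω (Multiplicative.ofAdd x) : ℂ)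

/-- The Fourier transform of an integrable function:
`𝓕 f (ω) = ∫ f(x) * conj (ω(x)) dμ(x)`. -/
def fourier (μ : Measure G) (f : G → ℂ) (ω : Dual G) : ℂ :=
  ∫ x, f x * starRingEnd ℂ (char ω x) ∂μ

/-- `ν` is the Plancherel measure on the dual group (the Haar measure dual to `μ`): the Haar
measure normalised so that the Fourier transform preserves the `L²`-norm on `L¹ ∩ L²`. -/
structure IsPlancherelMeasure (μ : Measure G) [MeasurableSpace (Dual G)]
    (ν : Measure (Dual G)) : Prop where
  isHaarMeasure : ν.IsHaarMeasure
  lintegral_fourier : ∀ f : G → ℂ, Integrable f μ → MemLp f 2 μ →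
    ∫⁻ ω, ‖fourier μ f ω‖ₑ ^ 2 ∂ν = ∫⁻ x, ‖f x‖ₑ ^ 2 ∂μ

/-- The subspace `L¹ ∩ L²` of `L²`. -/
def integrableLp (μ : Measure G) : Submodule ℂ (Lp ℂ 2 μ) where
  carrier := {f | Integrable f μ}
  add_mem' {f g} hf hg := (hf.add hg).congr (Lp.coeFn_add f g).symm
  zero_mem' := (integrable_zero G ℂ μ).congr (Lp.coeFn_zero ℂ 2 μ).symm
  smul_mem' c f hf := (Integrable.smul c hf).congr (Lp.coeFn_smul c f).symm

theorem dense_integrableLp (μ : Measure G) :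
    DenseRange (integrableLp μ).subtype := by
  have h : (Lp.simpleFunc ℂ 2 μ : Set (Lp ℂ 2 μ)) ⊆ integrableLp μ := by
    intro f hf
    have h1 : MemLp (Lp.simpleFunc.toSimpleFunc (⟨f, hf⟩ : Lp.simpleFunc ℂ 2 μ)) 2 μ :=
      Lp.simpleFunc.memLp _
    have h2 := (SimpleFunc.memLp_iff_integrable (by norm_num) (by norm_num)).1 h1
    exact h2.congr (Lp.simpleFunc.toSimpleFunc_eq_toFun _)
  have h3 : Dense (integrableLp μ : Set (Lp ℂ 2 μ)) :=
    (Lp.simpleFunc.dense (by norm_num)).mono h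
  simpa [DenseRange] using h3

theorem fourier_congr {μ : Measure G} {f g : G → ℂ} (h : f =ᵐ[μ] g) :
    fourier μ f = fourier μ g := by
  funext ω
  refine integral_congr_ae ?_
  filter_upwards [h] with x hx
  rw [hx]

theorem norm_char (ω : Dual G) (x : G) : ‖char ω x‖ = 1 :=
  Circle.norm_coe _

theorem continuous_char [IsTopologicalAddGroup G] (ω : Dual G) : Continuous (char ω) :=
  continuous_subtype_val.comp ((map_continuous ω).comp continuous_ofAdd)

theorem continuous_char_apply [IsTopologicalAddGroup G] (x : G) :
    Continuous fun ω : Dual G => char ω x := by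
  have h : Continuous fun ω : Dual G => ω (Multiplicative.ofAdd x) :=
    (continuous_eval_const (F := C(Multiplicative G, Circle)) (Multiplicative.ofAdd x)).comp
      (ContinuousMonoidHom.isInducing_toContinuousMap (Multiplicative G) Circle).continuous
  exact continuous_subtype_val.comp h

instance [IsTopologicalAddGroup G] [SecondCountableTopology G] [LocallyCompactSpace G] :
    SecondCountableTopology (Dual G) := by
  have : SecondCountableTopology (Multiplicative G) := ‹SecondCountableTopology G›
  exact (ContinuousMonoidHom.isInducing_toContinuousMap
    (Multiplicative G) Circle).secondCountableTopology

variable [IsTopologicalAddGroup G] [LocallyCompactSpace G] [SecondCountableTopology G]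
  [BorelSpace G]

theorem integrable_mul_char {μ : Measure G} {f : G → ℂ} (hf : Integrable f μ) (ω : Dual G) :
    Integrable (fun x => f x * starRingEnd ℂ (char ω x)) μ :=
  hf.mul_bdd (c := 1)
    (Complex.continuous_conj.comp (continuous_char ω)).aestronglyMeasurable
    (by filter_upwards with x; simp [norm_char])

theorem continuous_fourier {μ : Measure G} {f : G → ℂ} (hf : Integrable f μ) :
    Continuous (fourier μ f) := by
  refine continuous_of_dominated (bound := fun x => ‖f x‖)
    (fun ω => (integrable_mul_char hf ω).aestronglyMeasurable) ?_ hf.norm ?_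
  · intro ω
    filter_upwards with x
    simp [norm_char]
  · filter_upwards with x
    exact continuous_const.mul (Complex.continuous_conj.comp (continuous_char_apply x))

variable [MeasurableSpace (Dual G)] [BorelSpace (Dual G)]

theorem IsPlancherelMeasure.eLpNorm_fourier {μ : Measure G} {ν : Measure (Dual G)}
    (hν : IsPlancherelMeasure μ ν) {f : G → ℂ} (hf : Integrable f μ) (hf2 : MemLp f 2 μ) :
    eLpNorm (fourier μ f) 2 ν = eLpNorm f 2 μ := by
  have h := hν.lintegral_fourier f hf hf2
  simp only [eLpNorm_eq_lintegral_rpow_enorm_toReal (p := 2) (by norm_num) (by norm_num)]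
  simpa using congrArg (fun t : ℝ≥0∞ => t ^ (1 / 2 : ℝ)) h

theorem IsPlancherelMeasure.memLp_fourier {μ : Measure G} {ν : Measure (Dual G)}
    (hν : IsPlancherelMeasure μ ν) {f : G → ℂ} (hf : Integrable f μ) (hf2 : MemLp f 2 μ) :
    MemLp (fourier μ f) 2 ν :=
  ⟨(continuous_fourier hf).aestronglyMeasurable, by
    rw [hν.eLpNorm_fourier hf hf2]; exact hf2.2⟩

/-- The Fourier transform on `L¹ ∩ L²`, with values in `L²` of the dual group. -/
def fourierL1L2 {μ : Measure G} {ν : Measure (Dual G)} (hν : IsPlancherelMeasure μ ν) :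
    integrableLp μ →ₗ[ℂ] Lp ℂ 2 ν where
  toFun f := (hν.memLp_fourier f.2 (Lp.memLp f.1)).toLp _
  map_add' f g := by
    rw [← MemLp.toLp_add]
    refine MemLp.toLp_congr _ _ (Filter.Eventually.of_forall fun ω => ?_)
    have h1 : fourier μ ((f + g : integrableLp μ) : Lp ℂ 2 μ) =
        fourier μ ((f.1 : G → ℂ) + (g.1 : G → ℂ)) := fourier_congr (Lp.coeFn_add f.1 g.1)
    rw [h1]
    simp only [fourier, Pi.add_apply, add_mul]
    exact integral_add (integrable_mul_char f.2 ω) (integrable_mul_char g.2 ω)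
  map_smul' c f := by
    rw [RingHom.id_apply, ← MemLp.toLp_const_smul]
    refine MemLp.toLp_congr _ _ (Filter.Eventually.of_forall fun ω => ?_)
    have h1 : fourier μ ((c • f : integrableLp μ) : Lp ℂ 2 μ) =
        fourier μ (c • (f.1 : G → ℂ)) := fourier_congr (Lp.coeFn_smul c f.1)
    rw [h1]
    simp only [fourier, Pi.smul_apply, smul_eq_mul, mul_assoc]
    exact integral_const_mul c _

theorem norm_fourierL1L2 {μ : Measure G} {ν : Measure (Dual G)} (hν : IsPlancherelMeasure μ ν)
    (f : integrableLp μ) : ‖fourierL1L2 hν f‖ = ‖(integrableLp μ).subtype f‖ := by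
  change ‖(hν.memLp_fourier f.2 (Lp.memLp f.1)).toLp _‖ = ‖f.1‖
  rw [Lp.norm_toLp, hν.eLpNorm_fourier f.2 (Lp.memLp f.1), Lp.norm_def]

/-- The Fourier transform on `L²(G)`: the unique bounded linear extension of the Fourier
transform on `L¹ ∩ L²`. -/
def fourierL2 {μ : Measure G} {ν : Measure (Dual G)} (hν : IsPlancherelMeasure μ ν) :
    Lp ℂ 2 μ →L[ℂ] Lp ℂ 2 ν :=
  (fourierL1L2 hν).extendOfNorm (integrableLp μ).subtype

theorem fourierL2_coe {μ : Measure G} {ν : Measure (Dual G)} (hν : IsPlancherelMeasure μ ν)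
    (f : integrableLp μ) : fourierL2 hν (f : Lp ℂ 2 μ) = fourierL1L2 hν f :=
  LinearMap.extendOfNorm_eq (dense_integrableLp μ)
    ⟨1, fun x => by rw [one_mul, norm_fourierL1L2]⟩ f

end Fourier

section System

/-- The function `(p, x) ↦ h p x` is jointly measurable, and for every `p` the function `h p`
represents the `L²`-class `F p`. -/
structure IsJointVersion {P X : Type*} [MeasurableSpace P] [MeasurableSpace X] {ρ : Measure X}
    (F : P → Lp ℂ 2 ρ) (h : P → X → ℂ) : Prop where
  measurable : Measurable (Function.uncurry h)
  ae_eq : ∀ p, h p =ᵐ[ρ] F p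

/-- The standing hypotheses on a family `(g p)` of elements of `L²(G)`, indexed by a measure
space `P`. As elements of `L²(G)` are classes of functions, joint measurability of
`(p, x) ↦ g p x` means that representatives can be chosen in a jointly measurable way. -/
structure StandingHypotheses {G P : Type*} [MeasurableSpace G] [MeasurableSpace P]
    (μ : Measure G) (μP : Measure P) (g : P → Lp ℂ 2 μ) : Prop where
  sigmaFinite : SigmaFinite μP
  measurable : Measurable[_, borel (Lp ℂ 2 μ)] g
  joint : ∃ h : P → G → ℂ, IsJointVersion g h

variable {G : Type*} [AddCommGroup G] [TopologicalSpace G] [IsTopologicalAddGroup G]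
  [SecondCountableTopology G] [MeasurableSpace G] [BorelSpace G]

/-- The translate `T_y f = f(· - y)` of `f ∈ L²(G)`. -/
def translate {μ : Measure G} [μ.IsAddHaarMeasure] (y : G) (f : Lp ℂ 2 μ) : Lp ℂ 2 μ :=
  Lp.compMeasurePreserving (fun x => x - y) (measurePreserving_sub_right μ y) f

/-- The system `{T_γ g_p}`, `γ ∈ G`, `p ∈ P`, is a frame for `L²(G)` with frame bounds `A`, `B`. -/
def IsFrameWithBounds {P : Type*} [MeasurableSpace P] {μ : Measure G} [μ.IsAddHaarMeasure]
    (μP : Measure P) (g : P → Lp ℂ 2 μ) (A B : ℝ) : Prop :=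
  0 < A ∧ 0 < B ∧ ∀ f : Lp ℂ 2 μ,
    ENNReal.ofReal A * ‖f‖ₑ ^ 2 ≤ ∫⁻ p, ∫⁻ γ, ‖inner ℂ f (translate γ (g p))‖ₑ ^ 2 ∂μ ∂μP ∧
    ∫⁻ p, ∫⁻ γ, ‖inner ℂ f (translate γ (g p))‖ₑ ^ 2 ∂μ ∂μP ≤ ENNReal.ofReal B * ‖f‖ₑ ^ 2

end System

end TISystem

end

/-! For `f` in `L¹ ∩ L²` and `g` in `L²`, the coefficient `γ ↦ ⟨T_γ g, f⟩` is the convolution of `f`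
with `y ↦ conj (g (-y))`, so its Fourier transform should be `f̂ · conj ĝ`. Plancherel then gives `∫
|⟨f, T_γ g⟩|² dγ = ∫ |f̂|² |ĝ|² dω` (`eLpNorm_inner_translate`). Integrating over `p` and applying
Tonelli turns the frame expression into `∫ |f̂|² Φ dω` with `Φ(ω) = ∫ |ĝ_p(ω)|² dμ_P(p)`
(`analysisNorm_eq`). The frame inequality thus compares the `L²`-norms for `Φ dν` and `dν` on the
functions `f̂`.

These functions are dense in `L²(ν)` (`denseRange_fourierL1L2`), so the comparison extends to all of
`L²(ν)`, and indicator functions localise it to pointwise bounds on `Φ` (`ae_bounds_of_dense`).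
Density needs neither Fourier inversion nor Pontryagin duality: it rests on the fact that an
integrable function on the dual group with vanishing Fourier coefficients is zero.

All extensions from dense sets follow one pattern, since the seminorms involved could be infinite a
priori: Fatou carries the upper bound over, the upper bound makes the seminorm continuous, and
continuity carries over lower bounds and equalities. -/

noncomputable section

set_option linter.unusedSectionVars false

open Filter Topology

namespace TISystem

/-! ### Extended seminorms bounded on a dense set. -/

section Seminorm

variable {E : Type*} [NormedAddCommGroup E] {N : E → ℝ≥0∞} {C : ℝ≥0∞} {D : Set E}

/-- Sequential lower semicontinuity suffices: for `c' > C * ‖f‖ₑ`, a tail of any sequence in `D`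
tending to `f` stays in the sublevel set of `c'`. -/
theorem le_mul_enorm_of_dense (hD : Dense D) (hC : C ≠ ∞)
    (hlsc : ∀ (u : ℕ → E) (f : E), Tendsto u atTop (𝓝 f) →
      ∀ c, (∀ n, N (u n) ≤ c) → N f ≤ c)
    (hN : ∀ f ∈ D, N f ≤ C * ‖f‖ₑ) (f : E) : N f ≤ C * ‖f‖ₑ := by
  obtain ⟨u, huD, hu⟩ := mem_closure_iff_seq_limit.1 (hD f)
  have hu' : Tendsto (fun n => C * ‖u n‖ₑ) atTop (𝓝 (C * ‖f‖ₑ)) :=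
    ENNReal.Tendsto.const_mul ((continuous_enorm.tendsto f).comp hu) (Or.inr hC)
  refine le_of_forall_gt fun c hc => ?_
  obtain ⟨c', h1, h2⟩ := exists_between hc
  obtain ⟨n, hn⟩ := eventually_atTop.1 (hu'.eventually_lt_const h1)
  refine (hlsc (fun k => u (k + n)) f (hu.comp (tendsto_add_atTop_nat n)) c' fun k => ?_).trans_lt h2
  exact (hN _ (huD _)).trans (hn _ (Nat.le_add_left _ _)).le

theorem continuous_of_subadditive (hC : C ≠ ∞) (hadd : ∀ f g, N (f + g) ≤ N f + N g)
    (hN : ∀ f, N f ≤ C * ‖f‖ₑ) : Continuous N := by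
  refine continuous_of_le_add_edist C hC fun x y => ?_
  calc N x = N (y + (x - y)) := by rw [add_sub_cancel]
    _ ≤ N y + N (x - y) := hadd _ _
    _ ≤ N y + C * edist x y := by
      rw [edist_eq_enorm_sub]
      gcongr
      exact hN _

end Seminorm

/-! ### Uniqueness of Fourier coefficients on the dual group. -/

section Uniqueness

variable {G : Type*} [AddCommGroup G] [TopologicalSpace G] [MeasurableSpace G]

theorem char_add (ω : Dual G) (x y : G) : char ω (x + y) = char ω x * char ω y := by
  simp [char, ofAdd_add]

theorem char_zero (ω : Dual G) : char ω (0 : G) = 1 := by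
  simp [char]

theorem char_neg (ω : Dual G) (x : G) : char ω (-x) = starRingEnd ℂ (char ω x) := by
  rw [char, ofAdd_neg, map_inv, Circle.coe_inv_eq_conj, char]

theorem enorm_char (ω : Dual G) (x : G) : ‖char ω x‖ₑ = 1 := by
  rw [← ofReal_norm, norm_char, ENNReal.ofReal_one]

variable [IsTopologicalAddGroup G] [LocallyCompactSpace G] [SecondCountableTopology G]

/-- A locally compact group is complete, and second countability makes its uniformity countably
generated. Polishness lets a separating star algebra determine finite measures. -/
instance : PolishSpace (Dual G) := by
  let : UniformSpace (Dual G) := IsTopologicalGroup.rightUniformSpace (Dual G)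
  have : IsUniformGroup (Dual G) := isUniformGroup_of_commGroup
  have : LocallyCompactSpace (Multiplicative G) := ‹LocallyCompactSpace G›
  have : LocallyCompactSpace (Dual G) := inferInstance
  have : (uniformity (Dual G)).IsCountablyGenerated :=
    IsUniformGroup.uniformity_countably_generated
  have : CompleteSpace (Dual G) :=
    IsRightUniformGroup.completeSpace_of_weaklyLocallyCompactSpace
  infer_instance

/-- The evaluation characters of the dual group, as bounded continuous functions. -/
def evalChar (x : G) : BoundedContinuousFunction (Dual G) ℂ :=
  BoundedContinuousFunction.ofNormedAddCommGroup (fun ω => char ω x)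
    (continuous_char_apply x) 1 fun ω => (norm_char ω x).le

@[simp]
theorem evalChar_apply (x : G) (ω : Dual G) : evalChar x ω = char ω x := rfl

/-- The evaluation characters as a submonoid of the bounded continuous functions. -/
def evalCharSubmonoid (G : Type*) [AddCommGroup G] [TopologicalSpace G]
    [MeasurableSpace G]
    [IsTopologicalAddGroup G] [LocallyCompactSpace G] [SecondCountableTopology G] :
    Submonoid (BoundedContinuousFunction (Dual G) ℂ) where
  carrier := Set.range evalChar
  mul_mem' := by
    rintro _ _ ⟨x, rfl⟩ ⟨y, rfl⟩
    exact ⟨x + y, by ext ω; simp [char_add]⟩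
  one_mem' := ⟨0, by ext ω; simp [char_zero]⟩

theorem star_evalChar (x : G) : star (evalChar x) = evalChar (-x) := by
  ext ω
  simp [char_neg]

/-- Evaluations are closed under products and conjugation, so adjoining them adds only linear
combinations. -/
theorem mem_span_of_mem_adjoin {a : BoundedContinuousFunction (Dual G) ℂ}
    (ha : a ∈ StarAlgebra.adjoin ℂ (Set.range (evalChar (G := G)))) :
    a ∈ Submodule.span ℂ (Set.range (evalChar (G := G))) := by
  have h1 : Set.range (evalChar (G := G)) ∪ star (Set.range (evalChar (G := G))) =
      evalCharSubmonoid G := by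
    refine Set.union_eq_self_of_subset_right ?_
    rintro f ⟨x, hx⟩
    exact ⟨-x, by rw [← star_evalChar, hx, star_star]⟩
  have h2 := StarAlgebra.adjoin_eq_span (R := ℂ) (Set.range (evalChar (G := G)))
  rw [h1, Submonoid.closure_eq] at h2
  have h3 : a ∈ Submodule.span ℂ (evalCharSubmonoid G : Set _) := by
    rw [← h2]
    exact ha
  exact h3

variable [MeasurableSpace (Dual G)] [BorelSpace (Dual G)]

theorem integrable_mul_char_apply {ν : Measure (Dual G)} {u : Dual G → ℂ} (hu : Integrable u ν)
    (x : G) : Integrable (fun ω => u ω * char ω x) ν :=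
  hu.mul_bdd (c := 1) (continuous_char_apply x).aestronglyMeasurable
    (by filter_upwards with ω; simp [norm_char])

/-- The finite measures `u⁺ ν` and `u⁻ ν` have the same Fourier coefficients, hence agree on a
separating star algebra and coincide; so `u⁺ = u⁻` a.e. -/
theorem ae_eq_zero_of_integral_mul_char_eq_zero_of_real {ν : Measure (Dual G)}
    {u : Dual G → ℝ} (hu : Integrable u ν)
    (h : ∀ x : G, ∫ ω, (u ω : ℂ) * char ω x ∂ν = 0) : u =ᵐ[ν] 0 := by
  have hf1 := isFiniteMeasure_withDensity_ofReal hu.2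
  have hf2 := isFiniteMeasure_withDensity_ofReal hu.neg.2
  have hm1 : AEMeasurable (fun ω => ENNReal.ofReal (u ω)) ν := hu.1.aemeasurable.ennreal_ofReal
  have hm2 : AEMeasurable (fun ω => ENNReal.ofReal ((-u) ω)) ν :=
    hu.neg.1.aemeasurable.ennreal_ofReal
  have key : ∀ a ∈ StarAlgebra.adjoin ℂ (Set.range (evalChar (G := G))),
      ∫ ω, a ω ∂(ν.withDensity fun ω => ENNReal.ofReal (u ω)) =
        ∫ ω, a ω ∂(ν.withDensity fun ω => ENNReal.ofReal ((-u) ω)) := by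
    intro a ha
    have hspan := mem_span_of_mem_adjoin ha
    clear ha
    induction hspan using Submodule.span_induction with
    | mem a ha =>
      obtain ⟨x, rfl⟩ := ha
      have i1 : Integrable (fun ω => ((max (u ω) 0 : ℝ) : ℂ) * char ω x) ν :=
        integrable_mul_char_apply hu.pos_part.ofReal x
      have i2 : Integrable (fun ω => ((max (-u ω) 0 : ℝ) : ℂ) * char ω x) ν :=
        integrable_mul_char_apply hu.neg_part.ofReal x
      rw [integral_withDensity_eq_integral_toReal_smul₀ hm1 (by simp),
        integral_withDensity_eq_integral_toReal_smul₀ hm2 (by simp), ← sub_eq_zero]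
      simp only [ENNReal.toReal_ofReal', evalChar_apply, Complex.real_smul, Pi.neg_apply]
      rw [← integral_sub i1 i2, ← h x]
      refine integral_congr_ae (Eventually.of_forall fun ω => ?_)
      have : u ω = max (u ω) 0 - max (-u ω) 0 := by
        rcases le_total (u ω) 0 with h | h <;> simp [h]
      simp only
      conv_rhs => rw [this]
      push_cast
      ring
    | zero => simp
    | add a b _ _ ha hb =>
      simp only [BoundedContinuousFunction.coe_add, Pi.add_apply]
      rw [integral_add (a.integrable _) (b.integrable _),
        integral_add (a.integrable _) (b.integrable _), ha, hb]
    | smul c a _ ha =>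
      simp only [BoundedContinuousFunction.coe_smul]
      rw [integral_smul, integral_smul, ha]
  have hsep : ((StarAlgebra.adjoin ℂ (Set.range (evalChar (G := G)))).map
      (BoundedContinuousFunction.toContinuousMapStarₐ ℂ)).SeparatesPoints := by
    intro ω ω' hne
    have : ∃ x : G, char ω x ≠ char ω' x := by
      by_contra! hx
      exact hne (DFunLike.ext _ _ fun x => Subtype.ext (hx x.toAdd))
    obtain ⟨x, hx⟩ := this
    exact ⟨_, ⟨_, ⟨evalChar x, StarAlgebra.subset_adjoin ℂ _ ⟨x, rfl⟩, rfl⟩, rfl⟩, hx⟩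
  have heq := ext_of_forall_mem_subalgebra_integral_eq_of_polish hsep key
  have hfin : ∫⁻ ω, ENNReal.ofReal (u ω) ∂ν ≠ ∞ :=
    ((lintegral_mono fun ω => Real.ofReal_le_enorm (u ω)).trans_lt hu.2).ne
  filter_upwards [(withDensity_eq_iff hm1 hm2 hfin).1 heq] with ω hω
  rcases le_total (u ω) 0 with h0 | h0
  · rw [ENNReal.ofReal_of_nonpos h0, eq_comm, ENNReal.ofReal_eq_zero] at hω
    exact le_antisymm h0 (by simpa using hω)
  · rw [ENNReal.ofReal_of_nonpos (p := (-u) ω) (by simpa using h0), ENNReal.ofReal_eq_zero] at hω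
    exact le_antisymm hω h0

/-- An integrable function on the dual group is determined by its Fourier coefficients. -/
theorem ae_eq_zero_of_integral_mul_char_eq_zero {ν : Measure (Dual G)}
    {u : Dual G → ℂ} (hu : Integrable u ν)
    (h : ∀ x : G, ∫ ω, u ω * char ω x ∂ν = 0) : u =ᵐ[ν] 0 := by
  have hc : Integrable (fun ω => starRingEnd ℂ (u ω)) ν :=
    (LinearIsometryEquiv.integrable_comp_iff Complex.conjLIE).2 hu
  -- The coefficient of `conj u` at `x` is the conjugate of that of `u` at `-x`; real and imaginary
  -- parts are then covered by the real case.
  have hconj : ∀ x : G, ∫ ω, starRingEnd ℂ (u ω) * char ω x ∂ν = 0 := by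
    intro x
    have := congrArg (starRingEnd ℂ) (h (-x))
    rw [← integral_conj] at this
    simpa [char_neg] using this
  have hre : (fun ω => (u ω).re) =ᵐ[ν] 0 := by
    refine ae_eq_zero_of_integral_mul_char_eq_zero_of_real hu.re fun x => ?_
    have := integral_add (integrable_mul_char_apply hu x) (integrable_mul_char_apply hc x)
    rw [h, hconj, add_zero] at this
    rw [← mul_zero (1 / 2 : ℂ), ← this, ← integral_const_mul]
    refine integral_congr_ae (Eventually.of_forall fun ω => ?_)
    simp only [Complex.re_eq_add_conj]
    ring
  have him : (fun ω => (u ω).im) =ᵐ[ν] 0 := by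
    refine ae_eq_zero_of_integral_mul_char_eq_zero_of_real hu.im fun x => ?_
    have := integral_sub (integrable_mul_char_apply hu x) (integrable_mul_char_apply hc x)
    rw [h, hconj, sub_zero] at this
    rw [← mul_zero (1 / (2 * Complex.I) : ℂ), ← this, ← integral_const_mul]
    refine integral_congr_ae (Eventually.of_forall fun ω => ?_)
    simp only [Complex.im_eq_sub_conj]
    ring
  filter_upwards [hre, him] with ω h1 h2
  exact Complex.ext h1 h2

end Uniqueness

/-! ### Density of the Fourier image of `L¹ ∩ L²`. -/

section Density

variable {G : Type*} [AddCommGroup G] [TopologicalSpace G] [MeasurableSpace G]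
  [IsTopologicalAddGroup G] [LocallyCompactSpace G] [SecondCountableTopology G] [BorelSpace G]
  {μ : Measure G} [μ.IsAddHaarMeasure]

theorem fourier_comp_sub (f : G → ℂ) (y : G) (ω : Dual G) :
    fourier μ (fun x => f (x - y)) ω = fourier μ f ω * char ω (-y) := by
  have h : ∀ x, f (x - y) * starRingEnd ℂ (char ω x) =
      (fun z => f z * starRingEnd ℂ (char ω z) * char ω (-y)) (x - y) := by
    intro x
    have : x = (x - y) + y := by abel
    simp only
    conv_lhs => rw [this, char_add, add_sub_cancel_right, map_mul, ← char_neg ω y]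
    ring
  rw [fourier, integral_congr_ae (Eventually.of_forall h),
    integral_sub_right_eq_self (fun z => f z * starRingEnd ℂ (char ω z) * char ω (-y)) y,
    integral_mul_const, fourier]

/-- The Fourier transform of a suitable function does not vanish at a given character. -/
theorem exists_fourier_ne_zero (ω₀ : Dual G) :
    ∃ f : G → ℂ, Integrable f μ ∧ MemLp f 2 μ ∧ fourier μ f ω₀ ≠ 0 := by
  obtain ⟨K, hK, h0⟩ := exists_compact_mem_nhds (0 : G)
  have hpos : 0 < μ (closure K) :=
    Measure.measure_pos_of_mem_nhds μ (mem_of_superset h0 subset_closure)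
  have hfin : μ (closure K) < ∞ := hK.closure.measure_lt_top
  have hm : MeasurableSet (closure K) := isClosed_closure.measurableSet
  -- The witness is `ω₀` itself cut off to a compact neighbourhood of `0`; its transform at `ω₀` is
  -- the measure of that set.
  have hmem : ∀ p : ℝ≥0∞, MemLp ((closure K).indicator (char ω₀)) p μ := by
    intro p
    have h1 : MemLp ((closure K).indicator fun _ => (1 : ℂ)) p μ :=
      memLp_indicator_const p hm 1 (Or.inr hfin.ne)
    refine h1.of_le ((continuous_char ω₀).aestronglyMeasurable.indicator hm)
      (Eventually.of_forall fun x => ?_)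
    by_cases hx : x ∈ closure K <;> simp [hx, norm_char]
  refine ⟨_, memLp_one_iff_integrable.1 (hmem 1), hmem 2, ?_⟩
  have : fourier μ ((closure K).indicator (char ω₀)) ω₀ = μ.real (closure K) := by
    rw [fourier]
    have h1 : ∀ x, (closure K).indicator (char ω₀) x * starRingEnd ℂ (char ω₀ x) =
        (closure K).indicator (fun _ => (1 : ℂ)) x := by
      intro x
      by_cases hx : x ∈ closure K <;> simp [hx, Complex.mul_conj, Complex.normSq_eq_norm_sq, norm_char]
    simp_rw [h1]
    simp [integral_indicator hm]
  rw [this]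
  exact_mod_cast (ENNReal.toReal_pos hpos.ne' hfin.ne).ne'

variable [MeasurableSpace (Dual G)] [BorelSpace (Dual G)] {ν : Measure (Dual G)}

theorem coeFn_fourierL1L2_toLp (hν : IsPlancherelMeasure μ ν) {f : G → ℂ} (hf : Integrable f μ)
    (hf2 : MemLp f 2 μ) :
    fourierL1L2 hν ⟨hf2.toLp f, hf.congr hf2.coeFn_toLp.symm⟩ =ᵐ[ν] fourier μ f := by
  rw [← fourier_congr hf2.coeFn_toLp]
  exact (hν.memLp_fourier (hf.congr hf2.coeFn_toLp.symm) (Lp.memLp _)).coeFn_toLp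

/-- Translating `f` multiplies `f̂` by an evaluation character, so orthogonality to all translates
says that every Fourier coefficient of `f̂ · conj H` vanishes. Hence `f̂ · conj H = 0` a.e. for each
`f`. -/
theorem ae_eq_zero_of_orthogonal_range_fourier (hν : IsPlancherelMeasure μ ν) {H : Lp ℂ 2 ν}
    (hH : H ∈ (LinearMap.range (fourierL1L2 hν))ᗮ) : H =ᵐ[ν] 0 := by
  have key : ∀ f : G → ℂ, Integrable f μ → MemLp f 2 μ →
      (fun ω => fourier μ f ω * starRingEnd ℂ (H ω)) =ᵐ[ν] 0 := by
    intro f hf hf2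
    refine ae_eq_zero_of_integral_mul_char_eq_zero ?_ fun x => ?_
    · exact MemLp.integrable_mul (hν.memLp_fourier hf hf2) (Lp.memLp H).star
    · have hs : MeasurePreserving (fun z : G => z - (-x)) μ μ := measurePreserving_sub_right μ (-x)
      have hf' := hs.integrable_comp_of_integrable hf
      have hf2' := hf2.comp_measurePreserving hs
      have h1 := (Submodule.mem_orthogonal' _ _).1 hH _
        (LinearMap.mem_range_self (fourierL1L2 hν) ⟨hf2'.toLp _, hf'.congr hf2'.coeFn_toLp.symm⟩)
      rw [L2.inner_def] at h1
      rw [← h1]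
      refine integral_congr_ae ?_
      filter_upwards [coeFn_fourierL1L2_toLp hν hf' hf2'] with ω hω
      rw [hω]
      have := fourier_comp_sub (μ := μ) f (-x) ω
      rw [neg_neg] at this
      simp only [Function.comp_def, RCLike.inner_apply]
      rw [this]
      ring
  -- Near each `ω₀` some continuous `f̂` has no zeros, which forces `H = 0` a.e. there; second
  -- countability makes local nullity enough.
  refine measure_null_of_locally_null _ fun ω₀ _ => ?_
  obtain ⟨f, hf, hf2, h0⟩ := exists_fourier_ne_zero (μ := μ) ω₀
  have hU : {ω | fourier μ f ω ≠ 0} ∈ 𝓝 ω₀ :=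
    (isOpen_ne_fun (continuous_fourier hf) continuous_const).mem_nhds h0
  refine ⟨_, inter_mem_nhdsWithin _ hU, ?_⟩
  refine measure_mono_null ?_ (key f hf hf2)
  rintro ω ⟨h1, h2⟩ h3
  rcases mul_eq_zero.1 h3 with h | h
  · exact h2 h
  · exact h1 (by simpa using h)

/-- The image of `L¹ ∩ L²` under the Fourier transform is dense. -/
theorem denseRange_fourierL1L2 (hν : IsPlancherelMeasure μ ν) :
    DenseRange (fourierL1L2 hν) := by
  have h : (LinearMap.range (fourierL1L2 hν)).topologicalClosure = ⊤ := by
    rw [Submodule.topologicalClosure_eq_top_iff, eq_bot_iff]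
    intro H hH
    exact (Lp.eq_zero_iff_ae_eq_zero).2 (ae_eq_zero_of_orthogonal_range_fourier hν hH)
  have h2 := Submodule.dense_iff_topologicalClosure_eq_top.2 h
  rwa [LinearMap.coe_range] at h2

end Density

/-! ### Matrix coefficients as convolutions, and their `L²`-norms. -/

section Plancherel

variable {G : Type*} [AddCommGroup G] [TopologicalSpace G] [MeasurableSpace G]
  [IsTopologicalAddGroup G] [LocallyCompactSpace G] [SecondCountableTopology G] [BorelSpace G]
  {μ : Measure G} [μ.IsAddHaarMeasure]

theorem coeFn_translate (y : G) (f : Lp ℂ 2 μ) :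
    translate y f =ᵐ[μ] fun x => f (x - y) :=
  Lp.coeFn_compMeasurePreserving f (measurePreserving_sub_right μ y)

theorem isometry_translate (y : G) : Isometry (translate (μ := μ) y) :=
  Lp.isometry_compMeasurePreserving (measurePreserving_sub_right μ y)

theorem translate_add (y : G) (f g : Lp ℂ 2 μ) :
    translate y (f + g) = translate y f + translate y g :=
  map_add (Lp.compMeasurePreserving _ (measurePreserving_sub_right μ y)) f g

theorem norm_translate (y : G) (f : Lp ℂ 2 μ) : ‖translate y f‖ = ‖f‖ :=
  Lp.norm_compMeasurePreserving f (measurePreserving_sub_right μ y)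

theorem inner_translate_eq_integral (f g : Lp ℂ 2 μ) {k : G → ℂ} (hk : k =ᵐ[μ] g) (γ : G) :
    inner ℂ (translate γ g) f = ∫ x, f x * starRingEnd ℂ (k (x - γ)) ∂μ := by
  rw [L2.inner_def]
  refine integral_congr_ae ?_
  filter_upwards [coeFn_translate γ g,
    (measurePreserving_sub_right μ γ).quasiMeasurePreserving.ae_eq_comp hk] with x hx hx'
  simp only [RCLike.inner_apply, hx]
  simp only [Function.comp_def] at hx'
  rw [hx']

/-- The matrix coefficients `⟨T_γ g_p, f⟩` depend measurably on `(p, γ)`. -/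
theorem IsJointVersion.stronglyMeasurable_inner_translate {P : Type*} [MeasurableSpace P]
    {g : P → Lp ℂ 2 μ} {h : P → G → ℂ} (hg : IsJointVersion g h) (f : Lp ℂ 2 μ) :
    StronglyMeasurable fun q : P × G => inner ℂ (translate q.2 (g q.1)) f := by
  simp_rw [fun q : P × G => inner_translate_eq_integral f (g q.1) (hg.ae_eq q.1) q.2]
  refine StronglyMeasurable.integral_prod_right
    (f := fun (q : P × G) (x : G) => f x * starRingEnd ℂ (h q.1 (x - q.2))) ?_
  have h1 : Measurable fun r : (P × G) × G => h r.1.1 (r.2 - r.1.2) :=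
    hg.measurable.comp ((measurable_fst.comp measurable_fst).prodMk
      (measurable_snd.sub (measurable_snd.comp measurable_fst)))
  exact (((Lp.stronglyMeasurable f).measurable.comp measurable_snd).mul
    (Complex.continuous_conj.measurable.comp h1)).stronglyMeasurable

theorem stronglyMeasurable_inner_translate (f g : Lp ℂ 2 μ) :
    StronglyMeasurable fun γ : G => inner ℂ (translate γ g) f := by
  have h : IsJointVersion (fun _ : Unit => g) (fun _ => g) :=
    { measurable := (Lp.stronglyMeasurable g).measurable.comp measurable_snd
      ae_eq := fun _ => EventuallyEq.rfl }
  have h1 := (h.stronglyMeasurable_inner_translate f).comp_measurable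
    (measurable_prodMk_left (x := ()) : Measurable fun γ : G => ((), γ))
  simp only [Function.comp_def] at h1
  exact h1

open scoped Convolution in
theorem inner_translate_eq_convolution (f g : Lp ℂ 2 μ) :
    (fun γ => inner ℂ (translate γ g) f) =
      (f : G → ℂ) ⋆[ContinuousLinearMap.mul ℂ ℂ, μ] fun y => starRingEnd ℂ (g (-y)) := by
  funext γ
  rw [inner_translate_eq_integral f g EventuallyEq.rfl, convolution_def]
  simp

theorem integrable_conj_comp_neg {g : G → ℂ} (hg : Integrable g μ) :
    Integrable (fun y => starRingEnd ℂ (g (-y))) μ :=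
  (LinearIsometryEquiv.integrable_comp_iff Complex.conjLIE).2 hg.comp_neg

theorem integrable_inner_translate {f g : Lp ℂ 2 μ} (hf : Integrable f μ) (hg : Integrable g μ) :
    Integrable (fun γ => inner ℂ (translate γ g) f) μ := by
  rw [inner_translate_eq_convolution]
  exact hf.integrable_convolution _ (integrable_conj_comp_neg hg)

/-- The coefficient is integrable as a convolution and bounded by Cauchy–Schwarz, hence square
integrable. -/
theorem memLp_inner_translate {f g : Lp ℂ 2 μ} (hf : Integrable f μ) (hg : Integrable g μ) :
    MemLp (fun γ => inner ℂ (translate γ g) f) 2 μ := by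
  have h1 := integrable_inner_translate hf hg
  refine (memLp_two_iff_integrable_sq_norm h1.1).2 ?_
  simp_rw [sq]
  refine h1.norm.mul_bdd (c := ‖g‖ * ‖f‖) h1.1.norm (Eventually.of_forall fun γ => ?_)
  rw [norm_norm, ← norm_translate γ g]
  exact norm_inner_le_norm _ _

open scoped Convolution in
theorem fourier_inner_translate {f g : Lp ℂ 2 μ} (hf : Integrable f μ) (hg : Integrable g μ)
    (ω : Dual G) : fourier μ (fun γ => inner ℂ (translate γ g) f) ω =
      fourier μ f ω * starRingEnd ℂ (fourier μ g ω) := by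
  have h1 : ∀ γ, inner ℂ (translate γ g) f * starRingEnd ℂ (char ω γ) =
      ((fun x => f x * starRingEnd ℂ (char ω x)) ⋆[ContinuousLinearMap.mul ℂ ℂ, μ]
        fun y => starRingEnd ℂ (g (-y)) * starRingEnd ℂ (char ω y)) γ := by
    intro γ
    rw [inner_translate_eq_integral f g EventuallyEq.rfl, convolution_def, ← integral_mul_const]
    refine integral_congr_ae (Eventually.of_forall fun x => ?_)
    have h2 : char ω γ = char ω x * char ω (γ - x) := by rw [← char_add, add_sub_cancel]
    simp only [h2, ContinuousLinearMap.mul_apply', neg_sub, map_mul]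
    ring
  rw [fourier, integral_congr_ae (Eventually.of_forall h1), integral_convolution _
    (integrable_mul_char hf ω) (integrable_mul_char (integrable_conj_comp_neg hg) ω),
    ContinuousLinearMap.mul_apply', fourier, fourier, ← integral_conj,
    ← integral_neg_eq_self (fun x => starRingEnd ℂ (g x * starRingEnd ℂ (char ω x)))]
  simp [char_neg]

variable [MeasurableSpace (Dual G)] [BorelSpace (Dual G)] {ν : Measure (Dual G)}

theorem dense_integrableLp_coe (μ : Measure G) :
    Dense (integrableLp μ : Set (Lp ℂ 2 μ)) := by
  simpa [DenseRange] using dense_integrableLp μ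

theorem enorm_fourierL2 (hν : IsPlancherelMeasure μ ν) (f : Lp ℂ 2 μ) :
    ‖fourierL2 hν f‖ₑ = ‖f‖ₑ := by
  have h : (fun f => ‖fourierL2 hν f‖ₑ) = fun f => ‖f‖ₑ := by
    refine Continuous.ext_on (dense_integrableLp_coe μ)
      (continuous_enorm.comp (fourierL2 hν).continuous) continuous_enorm fun f hf => ?_
    have h1 := fourierL2_coe hν ⟨f, hf⟩
    have h2 := norm_fourierL1L2 hν ⟨f, hf⟩
    simp only at h1 h2
    simp only [h1, ← ofReal_norm, h2, Submodule.subtype_apply]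
  exact congrFun h f

theorem coeFn_fourierL2 (hν : IsPlancherelMeasure μ ν) {f : Lp ℂ 2 μ} (hf : Integrable f μ) :
    fourierL2 hν f =ᵐ[ν] fourier μ f := by
  have h1 := fourierL2_coe hν ⟨f, hf⟩
  simp only at h1
  rw [h1]
  exact (hν.memLp_fourier hf (Lp.memLp f)).coeFn_toLp

theorem enorm_fourier_le (f : G → ℂ) (ω : Dual G) : ‖fourier μ f ω‖ₑ ≤ eLpNorm f 1 μ := by
  rw [eLpNorm_one_eq_lintegral_enorm]
  refine (enorm_integral_le_lintegral_enorm _).trans (lintegral_mono fun x => ?_)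
  rw [enorm_mul, ← char_neg, enorm_char, mul_one]

theorem Lp.eLpNorm_eq_enorm {X : Type*} [MeasurableSpace X] {ρ : Measure X} (f : Lp ℂ 2 ρ) :
    eLpNorm f 2 ρ = ‖f‖ₑ := (Lp.enorm_def f).symm

theorem eLpNorm_fourier_mul_le {f : G → ℂ} (hf : Integrable f μ) (F : Lp ℂ 2 ν) :
    eLpNorm (fun ω => fourier μ f ω * F ω) 2 ν ≤ eLpNorm f 1 μ * ‖F‖ₑ := by
  rw [← Lp.eLpNorm_eq_enorm]
  have hfin : eLpNorm f 1 μ ≠ ∞ := (memLp_one_iff_integrable.2 hf).2.ne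
  lift eLpNorm f 1 μ to NNReal using hfin with C hC
  refine eLpNorm_le_mul_eLpNorm_of_ae_le_mul' (Eventually.of_forall fun ω => ?_) 2
  rw [enorm_mul, hC]
  gcongr
  exact enorm_fourier_le f ω

/-- Fatou's lemma for the `L²`-seminorm of a pointwise convergent sequence of functions. -/
theorem eLpNorm_le_of_tendsto {X : Type*} [MeasurableSpace X] {ρ : Measure X} {u : ℕ → X → ℂ}
    {v : X → ℂ} (hu : ∀ n, AEStronglyMeasurable (u n) ρ)
    (h : ∀ᵐ x ∂ρ, Tendsto (fun n => u n x) atTop (𝓝 (v x))) {c : ℝ≥0∞}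
    (hc : ∀ n, eLpNorm (u n) 2 ρ ≤ c) : eLpNorm v 2 ρ ≤ c :=
  (Lp.eLpNorm_lim_le_liminf_eLpNorm hu v h).trans
    (liminf_le_of_le (by isBoundedDefault) fun b hb => by
      obtain ⟨n, hn⟩ := hb.exists
      exact hn.trans (hc n))

/-- For integrable `f`, the matrix coefficient `γ ↦ ⟨T_γ g, f⟩` has the same `L²`-norm as the
product of the Fourier transforms of `f` and `g`. -/
theorem eLpNorm_inner_translate (hν : IsPlancherelMeasure μ ν) {f : Lp ℂ 2 μ}
    (hf : Integrable f μ) (g : Lp ℂ 2 μ) :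
    eLpNorm (fun γ => inner ℂ (translate γ g) f) 2 μ =
      eLpNorm (fun ω => fourier μ f ω * fourierL2 hν g ω) 2 ν := by
  set N : Lp ℂ 2 μ → ℝ≥0∞ := fun g => eLpNorm (fun γ => inner ℂ (translate γ g) f) 2 μ with hNdef
  set R : Lp ℂ 2 μ → ℝ≥0∞ :=
    fun g => eLpNorm (fun ω => fourier μ f ω * fourierL2 hν g ω) 2 ν with hRdef
  have hC : eLpNorm f 1 μ ≠ ∞ := (memLp_one_iff_integrable.2 hf).2.ne
  have hR : ∀ g, R g ≤ eLpNorm f 1 μ * ‖g‖ₑ := fun g => by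
    rw [← enorm_fourierL2 hν g]
    exact eLpNorm_fourier_mul_le hf _
  have heq : ∀ g ∈ (integrableLp μ : Set (Lp ℂ 2 μ)), N g = R g := by
    intro g hg
    simp only [hNdef, hRdef]
    rw [← hν.eLpNorm_fourier (integrable_inner_translate hf hg) (memLp_inner_translate hf hg)]
    refine eLpNorm_congr_enorm_ae ?_
    filter_upwards [coeFn_fourierL2 hν hg] with ω hω
    rw [fourier_inner_translate hf hg, hω, enorm_mul, enorm_mul, RCLike.enorm_conj]
  -- This is a case of Young's inequality, inherited on `L¹ ∩ L²` from the bound `|f̂| ≤ ‖f‖₁` and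
  -- extended by Fatou.
  have hN : ∀ g, N g ≤ eLpNorm f 1 μ * ‖g‖ₑ := by
    refine le_mul_enorm_of_dense (dense_integrableLp_coe μ) hC ?_
      fun g hg => (heq g hg).trans_le (hR g)
    intro u g hu c hc
    refine eLpNorm_le_of_tendsto
      (fun n => (stronglyMeasurable_inner_translate f (u n)).aestronglyMeasurable)
      (Eventually.of_forall fun γ => ?_) hc
    exact (((isometry_translate γ).continuous.tendsto g).comp hu).inner tendsto_const_nhds
  have hNadd : ∀ g g', N (g + g') ≤ N g + N g' := by
    intro g g'
    refine le_of_eq_of_le ?_ (eLpNorm_add_le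
      (stronglyMeasurable_inner_translate f g).aestronglyMeasurable
      (stronglyMeasurable_inner_translate f g').aestronglyMeasurable one_le_two)
    simp only [hNdef]
    congr 1
    funext γ
    rw [translate_add, inner_add_left, Pi.add_apply]
  have hmeas : ∀ g, AEStronglyMeasurable (fun ω => fourier μ f ω * fourierL2 hν g ω) ν :=
    fun g => (continuous_fourier hf).aestronglyMeasurable.mul (Lp.aestronglyMeasurable _)
  have hRadd : ∀ g g', R (g + g') ≤ R g + R g' := by
    intro g g'
    refine le_of_eq_of_le ?_ (eLpNorm_add_le (hmeas g) (hmeas g') one_le_two)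
    refine eLpNorm_congr_ae ?_
    rw [map_add]
    filter_upwards [Lp.coeFn_add (fourierL2 hν g) (fourierL2 hν g')] with ω hω
    rw [hω, Pi.add_apply, Pi.add_apply, mul_add]
  exact congrFun (Continuous.ext_on (dense_integrableLp_coe μ)
    (continuous_of_subadditive hC hNadd hN) (continuous_of_subadditive hC hRadd hR) heq) g

end Plancherel

/-! ### Jointly measurable representatives. -/

section JointVersion

variable {P X : Type*} [MeasurableSpace P] [MeasurableSpace X] {ρ : Measure X}

theorem eLpNorm_two_sq (f : X → ℂ) : eLpNorm f 2 ρ ^ 2 = ∫⁻ x, ‖f x‖ₑ ^ 2 ∂ρ := by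
  have := eLpNorm_nnreal_pow_eq_lintegral (f := f) (μ := ρ) (p := 2) two_ne_zero
  simpa using this

theorem Lp.enorm_sq (f : Lp ℂ 2 ρ) : ‖f‖ₑ ^ 2 = ∫⁻ x, ‖f x‖ₑ ^ 2 ∂ρ := by
  rw [← Lp.eLpNorm_eq_enorm, eLpNorm_two_sq]

theorem tendsto_enorm_zero_of_sq {u : ℕ → ℝ≥0∞} (h : Tendsto (fun n => u n ^ 2) atTop (𝓝 0)) :
    Tendsto u atTop (𝓝 0) := by
  have h1 := (ENNReal.continuous_rpow_const (y := 1 / 2)).tendsto 0 |>.comp h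
  have h2 : (0 : ℝ≥0∞) ^ (1 / 2 : ℝ) = 0 := by simp
  rw [h2] at h1
  refine h1.congr fun n => ?_
  simp only [Function.comp_apply]
  rw [← ENNReal.rpow_natCast, ← ENNReal.rpow_mul]
  norm_num

/-- A sequence that converges fast enough in `L²` converges almost everywhere. -/
theorem ae_tendsto_of_enorm_sub_le {u : ℕ → Lp ℂ 2 ρ} {f : Lp ℂ 2 ρ} {b : ℕ → ℝ≥0∞}
    (hb : ∑' n, b n ^ 2 ≠ ∞) (h : ∀ n, ‖u n - f‖ₑ ≤ b n) :
    ∀ᵐ x ∂ρ, Tendsto (fun n => u n x) atTop (𝓝 (f x)) := by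
  have hm : ∀ n, AEMeasurable (fun x => ‖(u n - f : Lp ℂ 2 ρ) x‖ₑ ^ 2) ρ := fun n =>
    ((Lp.aestronglyMeasurable _).enorm).pow_const 2
  have hfin : ∫⁻ x, ∑' n, ‖(u n - f : Lp ℂ 2 ρ) x‖ₑ ^ 2 ∂ρ ≠ ∞ := by
    rw [lintegral_tsum hm]
    refine ne_top_of_le_ne_top hb (ENNReal.tsum_le_tsum fun n => ?_)
    rw [← Lp.enorm_sq]
    gcongr
    exact h n
  filter_upwards [ae_lt_top' (AEMeasurable.tsum hm) hfin,
    ae_all_iff.2 fun n => Lp.coeFn_sub (u n) f] with x hx hsub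
  have h0 := tendsto_enorm_zero_of_sq (ENNReal.tendsto_atTop_zero_of_tsum_ne_top hx.ne)
  rw [tendsto_iff_edist_tendsto_0]
  refine h0.congr fun n => ?_
  rw [hsub n, Pi.sub_apply, edist_eq_enorm_sub]

/-- A measurable map into `L²` has a jointly measurable family of representatives. -/
theorem exists_isJointVersion [SecondCountableTopology (Lp ℂ 2 ρ)] {F : P → Lp ℂ 2 ρ}
    (hF : Measurable[_, borel (Lp ℂ 2 ρ)] F) : ∃ h : P → X → ℂ, IsJointVersion F h := by
  classical
  borelize ↥(Lp ℂ 2 ρ)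
  set d := TopologicalSpace.denseSeq (Lp ℂ 2 ρ) with hd
  -- Approximating `F p` by the first `d k` within `2⁻ⁿ` uses countably many classes, so joint
  -- measurability is immediate; the rate makes the squared errors summable.
  have hex : ∀ (n : ℕ) (p : P), ∃ k, edist (d k) (F p) < 2⁻¹ ^ n := by
    intro n p
    obtain ⟨k, hk⟩ := (TopologicalSpace.denseRange_denseSeq (Lp ℂ 2 ρ)).exists_mem_open
      (Metric.isOpen_eball (x := F p) (ε := 2⁻¹ ^ n))
      ⟨F p, Metric.mem_eball_self (ENNReal.pow_pos (by simp) n)⟩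
    exact ⟨k, hk⟩
  have hk : ∀ n, Measurable fun p => Nat.find (hex n p) := fun n =>
    measurable_find (hex n) fun k =>
      measurableSet_lt (measurable_const.edist hF) measurable_const
  have hdm : Measurable fun q : ℕ × X => d q.1 q.2 :=
    measurable_from_prod_countable_right fun k => (Lp.stronglyMeasurable (d k)).measurable
  have hS : ∀ n, StronglyMeasurable fun q : P × X => d (Nat.find (hex n q.1)) q.2 := fun n =>
    (hdm.comp (((hk n).comp measurable_fst).prodMk measurable_snd)).stronglyMeasurable
  -- For each `p` the default value of `limUnder` matters only on a null set of `x`.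
  refine ⟨fun p x => limUnder atTop fun n => d (Nat.find (hex n p)) x,
    (StronglyMeasurable.limUnder (l := atTop) hS).measurable, fun p => ?_⟩
  have hsum : ∑' n : ℕ, ((2⁻¹ : ℝ≥0∞) ^ n) ^ 2 ≠ ∞ := by
    simp_rw [← pow_mul, mul_comm _ 2, pow_mul]
    rw [ENNReal.tsum_geometric]
    refine ENNReal.inv_ne_top.2 (tsub_pos_of_lt ?_).ne'
    exact pow_lt_one₀ zero_le (by simp) two_ne_zero
  filter_upwards [ae_tendsto_of_enorm_sub_le hsum fun n => by
    rw [← edist_eq_enorm_sub]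
    exact (Nat.find_spec (hex n p)).le] with x hx
  exact hx.limUnder_eq

end JointVersion

/-! ### Comparing weighted and unweighted `L²`-norms. -/

section Weighted

variable {X : Type*} [MeasurableSpace X] {ρ : Measure X} {Φ : X → ℝ≥0∞}

theorem eLpNorm_withDensity_sq (hΦ : Measurable Φ) (F : Lp ℂ 2 ρ) :
    eLpNorm F 2 (ρ.withDensity Φ) ^ 2 = ∫⁻ x, Φ x * ‖F x‖ₑ ^ 2 ∂ρ := by
  rw [eLpNorm_two_sq, lintegral_withDensity_eq_lintegral_mul ρ hΦ
    ((Lp.stronglyMeasurable F).measurable.enorm.pow_const 2)]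
  rfl

theorem eLpNorm_withDensity_congr {f g : X → ℂ} (h : f =ᵐ[ρ] g) :
    eLpNorm f 2 (ρ.withDensity Φ) = eLpNorm g 2 (ρ.withDensity Φ) :=
  eLpNorm_congr_ae ((withDensity_absolutelyContinuous ρ Φ).ae_eq h)

/-- An a.e. convergent subsequence for `ρ` also converges a.e. for the weighted measure, where Fatou
applies. -/
theorem eLpNorm_withDensity_le_of_tendsto {u : ℕ → Lp ℂ 2 ρ} {F : Lp ℂ 2 ρ}
    (hu : Tendsto u atTop (𝓝 F)) {c : ℝ≥0∞}
    (hc : ∀ n, eLpNorm (u n) 2 (ρ.withDensity Φ) ≤ c) : eLpNorm F 2 (ρ.withDensity Φ) ≤ c := by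
  obtain ⟨s, -, hs⟩ := (tendstoInMeasure_of_tendsto_Lp hu).exists_seq_tendsto_ae
  exact eLpNorm_le_of_tendsto
    (fun n => (Lp.stronglyMeasurable (u (s n))).aestronglyMeasurable)
    ((withDensity_absolutelyContinuous ρ Φ).ae_le hs) fun n => hc (s n)

theorem eLpNorm_withDensity_add_le (F F' : Lp ℂ 2 ρ) :
    eLpNorm (F + F' : Lp ℂ 2 ρ) 2 (ρ.withDensity Φ) ≤
      eLpNorm F 2 (ρ.withDensity Φ) + eLpNorm F' 2 (ρ.withDensity Φ) := by
  rw [eLpNorm_withDensity_congr (Lp.coeFn_add F F')]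
  exact eLpNorm_add_le (Lp.stronglyMeasurable F).aestronglyMeasurable
    (Lp.stronglyMeasurable F').aestronglyMeasurable one_le_two

/-- Two-sided bounds between weighted and unweighted `L²`-norms on a dense set are bounds for the
weight. -/
theorem ae_bounds_of_dense [SigmaFinite ρ] (hΦ : Measurable Φ) {a b : ℝ≥0∞} (ha : a ≠ ∞)
    (hb : b ≠ ∞) {D : Set (Lp ℂ 2 ρ)} (hD : Dense D)
    (h : ∀ F ∈ D, a * ‖F‖ₑ ≤ eLpNorm F 2 (ρ.withDensity Φ) ∧
      eLpNorm F 2 (ρ.withDensity Φ) ≤ b * ‖F‖ₑ) :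
    ∀ᵐ x ∂ρ, a ^ 2 ≤ Φ x ∧ Φ x ≤ b ^ 2 := by
  have hub : ∀ F : Lp ℂ 2 ρ, eLpNorm F 2 (ρ.withDensity Φ) ≤ b * ‖F‖ₑ :=
    le_mul_enorm_of_dense hD hb (fun _ _ hu _ => eLpNorm_withDensity_le_of_tendsto hu)
      fun F hF => (h F hF).2
  have hcont := continuous_of_subadditive hb eLpNorm_withDensity_add_le hub
  have hlb : ∀ F : Lp ℂ 2 ρ, a * ‖F‖ₑ ≤ eLpNorm F 2 (ρ.withDensity Φ) := fun F =>
    (isClosed_le ((ENNReal.continuous_const_mul ha).comp continuous_enorm) hcont).closure_subset_iff.2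
      (fun F hF => (h F hF).1) (hD F)
  -- Testing on the indicator of `s` turns the norm bounds, squared, into bounds on the integral of
  -- `Φ` over `s`.
  have hset : ∀ s (hs : MeasurableSet s) (hfin : ρ s < ∞),
      a ^ 2 * ρ s ≤ ∫⁻ x in s, Φ x ∂ρ ∧ ∫⁻ x in s, Φ x ∂ρ ≤ b ^ 2 * ρ s := by
    intro s hs hfin
    set F := indicatorConstLp 2 hs hfin.ne (1 : ℂ) with hF
    have h1 : ∀ᵐ x ∂ρ, ‖F x‖ₑ ^ 2 = s.indicator 1 x := by
      filter_upwards [indicatorConstLp_coeFn (p := 2) (hs := hs) (hμs := hfin.ne) (c := (1 : ℂ))]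
        with x hx
      rw [hF, hx]
      by_cases hxs : x ∈ s <;> simp [hxs]
    have h2 : ‖F‖ₑ ^ 2 = ρ s := by
      rw [Lp.enorm_sq, lintegral_congr_ae h1, lintegral_indicator_one hs]
    have h3 : eLpNorm F 2 (ρ.withDensity Φ) ^ 2 = ∫⁻ x in s, Φ x ∂ρ := by
      rw [eLpNorm_withDensity_sq hΦ, ← lintegral_indicator hs]
      refine lintegral_congr_ae ?_
      filter_upwards [h1] with x hx
      rw [hx]
      by_cases hxs : x ∈ s <;> simp [hxs]
    rw [← h2, ← h3, ← mul_pow, ← mul_pow]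
    exact ⟨pow_le_pow_left₀ zero_le (hlb F) 2, pow_le_pow_left₀ zero_le (hub F) 2⟩
  have hA : (fun _ => a ^ 2) ≤ᵐ[ρ] Φ :=
    ae_le_of_forall_setLIntegral_le_of_sigmaFinite measurable_const fun s hs hfin => by
      simpa using (hset s hs hfin).1
  have hB : Φ ≤ᵐ[ρ] fun _ => b ^ 2 :=
    ae_le_of_forall_setLIntegral_le_of_sigmaFinite hΦ fun s hs hfin => by
      simpa using (hset s hs hfin).2
  filter_upwards [hA, hB] with x h1 h2 using ⟨h1, h2⟩

theorem bounds_of_ae (hΦ : Measurable Φ) {a b : ℝ≥0∞}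
    (h : ∀ᵐ x ∂ρ, a ^ 2 ≤ Φ x ∧ Φ x ≤ b ^ 2) (F : Lp ℂ 2 ρ) :
    a * ‖F‖ₑ ≤ eLpNorm F 2 (ρ.withDensity Φ) ∧ eLpNorm F 2 (ρ.withDensity Φ) ≤ b * ‖F‖ₑ := by
  have hm : Measurable fun x => ‖F x‖ₑ ^ 2 :=
    (Lp.stronglyMeasurable F).measurable.enorm.pow_const 2
  rw [← ENNReal.pow_le_pow_left_iff two_ne_zero (a := a * ‖F‖ₑ),
    ← ENNReal.pow_le_pow_left_iff two_ne_zero (b := b * ‖F‖ₑ), mul_pow, mul_pow, eLpNorm_withDensity_sq hΦ, Lp.enorm_sq, ← lintegral_const_mul _ hm,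
    ← lintegral_const_mul _ hm]
  constructor <;>
  · refine lintegral_mono_ae ?_
    filter_upwards [h] with x hx
    gcongr
    first | exact hx.1 | exact hx.2

end Weighted

/-! ### The frame inequality as a weighted norm inequality. -/

section Frame

variable {G : Type*} [AddCommGroup G] [TopologicalSpace G] [MeasurableSpace G]
  [IsTopologicalAddGroup G] [LocallyCompactSpace G] [SecondCountableTopology G] [BorelSpace G]
  {μ : Measure G} [μ.IsAddHaarMeasure] {P : Type*} [MeasurableSpace P] {μP : Measure P}

theorem enorm_inner_symm {E : Type*} [NormedAddCommGroup E] [InnerProductSpace ℂ E] (x y : E) :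
    ‖inner ℂ x y‖ₑ = ‖inner ℂ y x‖ₑ := by
  rw [← ofReal_norm, norm_inner_symm, ofReal_norm]

/-- The `L²`-norm of the analysis coefficients of `f` with respect to the system `{T_γ g_p}`. -/
def analysisNorm (μP : Measure P) (g : P → Lp ℂ 2 μ) (f : Lp ℂ 2 μ) : ℝ≥0∞ :=
  eLpNorm (fun q : P × G => inner ℂ (translate q.2 (g q.1)) f) 2 (μP.prod μ)

variable {g : P → Lp ℂ 2 μ} {k : P → G → ℂ}

theorem analysisNorm_sq [SFinite μP] (hk : IsJointVersion g k) (f : Lp ℂ 2 μ) :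
    analysisNorm μP g f ^ 2 =
      ∫⁻ p, ∫⁻ γ, ‖inner ℂ f (translate γ (g p))‖ₑ ^ 2 ∂μ ∂μP := by
  rw [analysisNorm, eLpNorm_two_sq, lintegral_prod _
    ((hk.stronglyMeasurable_inner_translate f).measurable.enorm.pow_const 2).aemeasurable]
  simp_rw [enorm_inner_symm f]

/-- Writing the bounds as squares lets the condition be stated for a subadditive functional, to
which the density arguments apply. -/
theorem isFrameWithBounds_iff [SFinite μP] (hk : IsJointVersion g k) {a b : ℝ} (ha : 0 < a)
    (hb : 0 < b) : IsFrameWithBounds μP g (a ^ 2) (b ^ 2) ↔ ∀ f : Lp ℂ 2 μ,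
      ENNReal.ofReal a * ‖f‖ₑ ≤ analysisNorm μP g f ∧
        analysisNorm μP g f ≤ ENNReal.ofReal b * ‖f‖ₑ := by
  have h1 : 0 < a ^ 2 := by positivity
  have h2 : 0 < b ^ 2 := by positivity
  simp only [IsFrameWithBounds, h1, h2, true_and, ← analysisNorm_sq hk,
    ENNReal.ofReal_pow ha.le, ENNReal.ofReal_pow hb.le, ← mul_pow,
    ENNReal.pow_le_pow_left_iff two_ne_zero]

theorem analysisNorm_add_le (hk : IsJointVersion g k) (f f' : Lp ℂ 2 μ) :
    analysisNorm μP g (f + f') ≤ analysisNorm μP g f + analysisNorm μP g f' := by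
  refine le_of_eq_of_le ?_ (eLpNorm_add_le
    (hk.stronglyMeasurable_inner_translate f).aestronglyMeasurable
    (hk.stronglyMeasurable_inner_translate f').aestronglyMeasurable one_le_two)
  rw [analysisNorm]
  congr 1
  funext q
  rw [inner_add_right, Pi.add_apply]

theorem analysisNorm_le_of_tendsto (hk : IsJointVersion g k) {u : ℕ → Lp ℂ 2 μ} {f : Lp ℂ 2 μ}
    (hu : Tendsto u atTop (𝓝 f)) {c : ℝ≥0∞} (hc : ∀ n, analysisNorm μP g (u n) ≤ c) :
    analysisNorm μP g f ≤ c :=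
  eLpNorm_le_of_tendsto
    (fun n => (hk.stronglyMeasurable_inner_translate (u n)).aestronglyMeasurable)
    (Eventually.of_forall fun _ => tendsto_const_nhds.inner hu) hc

/-- Frame bounds need to be checked on a dense set only. -/
theorem analysisNorm_bounds_of_dense (hk : IsJointVersion g k) {a b : ℝ≥0∞} (ha : a ≠ ∞)
    (hb : b ≠ ∞) {D : Set (Lp ℂ 2 μ)} (hD : Dense D)
    (h : ∀ f ∈ D, a * ‖f‖ₑ ≤ analysisNorm μP g f ∧ analysisNorm μP g f ≤ b * ‖f‖ₑ)
    (f : Lp ℂ 2 μ) :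
    a * ‖f‖ₑ ≤ analysisNorm μP g f ∧ analysisNorm μP g f ≤ b * ‖f‖ₑ := by
  have hub : ∀ f, analysisNorm μP g f ≤ b * ‖f‖ₑ :=
    le_mul_enorm_of_dense hD hb (fun _ _ hu _ => analysisNorm_le_of_tendsto hk hu)
      fun f hf => (h f hf).2
  have hcont := continuous_of_subadditive hb (analysisNorm_add_le (μP := μP) hk) hub
  exact ⟨(isClosed_le ((ENNReal.continuous_const_mul ha).comp continuous_enorm)
    hcont).closure_subset_iff.2 (fun f hf => (h f hf).1) (hD f), hub f⟩

variable [MeasurableSpace (Dual G)] [BorelSpace (Dual G)] {ν : Measure (Dual G)}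

theorem IsPlancherelMeasure.sigmaFinite (hν : IsPlancherelMeasure μ ν) : SigmaFinite ν := by
  have := hν.isHaarMeasure
  have : LocallyCompactSpace (Multiplicative G) := ‹LocallyCompactSpace G›
  have : LocallyCompactSpace (Dual G) := inferInstance
  infer_instance

theorem IsJointVersion.measurable_lintegral_sq [SFinite μP] {X : Type*} [MeasurableSpace X]
    {ρ : Measure X} {F : P → Lp ℂ 2 ρ} {h : P → X → ℂ} (hh : IsJointVersion F h) :
    Measurable fun x => ∫⁻ p, ‖h p x‖ₑ ^ 2 ∂μP :=
  (hh.measurable.enorm.pow_const 2).lintegral_prod_left'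

/-- On `L¹ ∩ L²`, the analysis coefficients of `f` are controlled by the function
`ω ↦ ∫ |ĝ_p(ω)|² dμ_P(p)`. -/
theorem analysisNorm_eq [SFinite μP] (hν : IsPlancherelMeasure μ ν) (hk : IsJointVersion g k)
    {h : P → Dual G → ℂ} (hh : IsJointVersion (fun p => fourierL2 hν (g p)) h)
    {f : Lp ℂ 2 μ} (hf : Integrable f μ) :
    analysisNorm μP g f =
      eLpNorm (fourierL2 hν f) 2 (ν.withDensity fun ω => ∫⁻ p, ‖h p ω‖ₑ ^ 2 ∂μP) := by
  have := hν.sigmaFinite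
  rw [← (ENNReal.pow_right_strictMono two_ne_zero).injective.eq_iff, eLpNorm_withDensity_sq hh.measurable_lintegral_sq,
    analysisNorm_sq hk]
  have h1 : ∀ p, ∫⁻ γ, ‖inner ℂ f (translate γ (g p))‖ₑ ^ 2 ∂μ =
      ∫⁻ ω, ‖h p ω‖ₑ ^ 2 * ‖fourierL2 hν f ω‖ₑ ^ 2 ∂ν := by
    intro p
    have h2 := congrArg (· ^ 2) (eLpNorm_inner_translate hν hf (g p))
    simp only [eLpNorm_two_sq] at h2
    simp_rw [enorm_inner_symm f, h2]
    refine lintegral_congr_ae ?_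
    filter_upwards [hh.ae_eq p, coeFn_fourierL2 hν hf] with ω h3 h4
    rw [h3, h4, enorm_mul, mul_pow, mul_comm]
  have hm : Measurable fun q : P × Dual G => ‖h q.1 q.2‖ₑ ^ 2 * ‖fourierL2 hν f q.2‖ₑ ^ 2 :=
    (hh.measurable.enorm.pow_const 2).mul
      (((Lp.stronglyMeasurable _).measurable.comp measurable_snd).enorm.pow_const 2)
  simp_rw [h1]
  -- After Plancherel for each `p`, Tonelli collects the weight `Φ`; this is where joint
  -- measurability of `h` enters.
  rw [lintegral_lintegral_swap hm.aemeasurable]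
  refine lintegral_congr fun ω => ?_
  rw [lintegral_mul_const]
  exact (hh.measurable.comp (measurable_prodMk_right (y := ω))).enorm.pow_const 2

/-- The system `{T_γ g_p}` is a frame with bounds `a²` and `b²` exactly if
`a² ≤ ∫ |ĝ_p(ω)|² dμ_P(p) ≤ b²` for almost every `ω`. -/
theorem isFrameWithBounds_sq_iff [SFinite μP] (hν : IsPlancherelMeasure μ ν)
    (hk : IsJointVersion g k) {h : P → Dual G → ℂ}
    (hh : IsJointVersion (fun p => fourierL2 hν (g p)) h) {a b : ℝ} (ha : 0 < a) (hb : 0 < b) :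
    IsFrameWithBounds μP g (a ^ 2) (b ^ 2) ↔
      ∀ᵐ ω ∂ν, ENNReal.ofReal (a ^ 2) ≤ ∫⁻ p, ‖h p ω‖ₑ ^ 2 ∂μP ∧
        ∫⁻ p, ‖h p ω‖ₑ ^ 2 ∂μP ≤ ENNReal.ofReal (b ^ 2) := by
  have := hν.sigmaFinite
  rw [isFrameWithBounds_iff hk ha hb, ENNReal.ofReal_pow ha.le, ENNReal.ofReal_pow hb.le]
  constructor
  · intro H
    refine ae_bounds_of_dense hh.measurable_lintegral_sq ENNReal.ofReal_ne_top
      ENNReal.ofReal_ne_top (denseRange_fourierL1L2 hν) ?_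
    rintro _ ⟨f, rfl⟩
    rw [← fourierL2_coe, enorm_fourierL2, ← analysisNorm_eq hν hk hh f.2]
    exact H f
  · intro H
    refine analysisNorm_bounds_of_dense hk ENNReal.ofReal_ne_top ENNReal.ofReal_ne_top
      (dense_integrableLp_coe μ) fun f hf => ?_
    rw [analysisNorm_eq hν hk hh hf, ← enorm_fourierL2 hν f]
    exact bounds_of_ae hh.measurable_lintegral_sq H _

end Frame

end TISystem

end

open TISystem in
theorem mainTheorem4 {G : Type*} [AddCommGroup G] [TopologicalSpace G]
    [IsTopologicalAddGroup G] [LocallyCompactSpace G] [T2Space G] [SecondCountableTopology G]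
    [MeasurableSpace G] [BorelSpace G]
    [MeasurableSpace (TISystem.Dual G)] [BorelSpace (TISystem.Dual G)]
    (μ : Measure G) [μ.IsAddHaarMeasure]
    (ν : Measure (TISystem.Dual G)) (hν : IsPlancherelMeasure μ ν)
    {P : Type*} [MeasurableSpace P] (μP : Measure P)
    (g : P → Lp ℂ 2 μ) (hg : StandingHypotheses μ μP g)
    (A B : ℝ) (hA : 0 < A) (hAB : A ≤ B) :
    (∃ h : P → TISystem.Dual G → ℂ, IsJointVersion (fun p => fourierL2 hν (g p)) h) ∧
    ∀ h : P → TISystem.Dual G → ℂ, IsJointVersion (fun p => fourierL2 hν (g p)) h →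
      (IsFrameWithBounds μP g A B ↔
        ∀ᵐ ω ∂ν, ENNReal.ofReal A ≤ ∫⁻ p, ‖h p ω‖ₑ ^ 2 ∂μP ∧
          ∫⁻ p, ‖h p ω‖ₑ ^ 2 ∂μP ≤ ENNReal.ofReal B) := by
  have := hg.sigmaFinite
  have := hν.sigmaFinite
  obtain ⟨k, hk⟩ := hg.joint
  refine ⟨?_, fun h hh => ?_⟩
  · borelize ↥(Lp ℂ 2 μ) ↥(Lp ℂ 2 ν)
    -- Finiteness of the exponent gives second countability of `L²(ν)`.
    have : Fact ((2 : ℝ≥0∞) ≠ ∞) := ⟨ENNReal.ofNat_ne_top⟩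
    exact exists_isJointVersion ((fourierL2 hν).continuous.measurable.comp hg.measurable)
  · have hB : 0 < B := hA.trans_le hAB
    have key := isFrameWithBounds_sq_iff (μP := μP) hν hk hh (Real.sqrt_pos.2 hA)
      (Real.sqrt_pos.2 hB)
    rwa [Real.sq_sqrt hA.le, Real.sq_sqrt hB.le] at key
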